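/- Let $n\ge 3$ be an integer, let $n<p<\infty$ and let $r_0>0$. Let $L:\mathbb{R}^n\to[0,\infty)$ be a $C^1$-function with $L(x)=e^{|x|}$ for $|x|\ge r_0$, which is strictly convex in the ball $B(0,r_0)$ and satisfies $L(0)=0$ and $DL(0)=0$. (Such $L$ exist exactly when $r_0>1$.) For $u:\mathbb{R}^n\to\mathbb{R}$ continuous and bounded and $t>0$ put $$u_t(x)=\inf_{y\in\mathbb{R}^n}\Big(u(y)+t\,L\Big(\frac{y-x}{t}\Big)\Big),\qquad x\in\mathbb{R}^n .$$ Then there is no constant $C>0$ such that $|DL(x)|\le C\,L(x)/|x|$ for all $x\neq0$, and there exists a continuous, compactly supported function $u\in W^{1,p}(\mathbb{R}^n)$ such that $u_t$ is Lipschitz (hence differentiable almost everywhere) for every $t>0$ and $$\|Du_t\|_{L^p(\mathbb{R}^n)}\to\infty\quad\text{as } t\to0^+ .$$ -/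

import Mathlib

open MeasureTheory Filter Topology
open scoped ContDiff ENNReal

/-- `G` is a weak (distributional) gradient of `u` on the whole of `ℝⁿ`:
`∫ u ∂ᵥφ = - ∫ ⟨G, v⟩ φ` for every test function `φ ∈ C_c^∞(ℝⁿ)` and every direction `v`. -/
def HasWeakGradient {n : ℕ} (u : EuclideanSpace ℝ (Fin n) → ℝ)
    (G : EuclideanSpace ℝ (Fin n) → EuclideanSpace ℝ (Fin n)) : Prop :=
  LocallyIntegrable u volume ∧ LocallyIntegrable G volume ∧
    ∀ φ : EuclideanSpace ℝ (Fin n) → ℝ, ContDiff ℝ ∞ φ → HasCompactSupport φ →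
      ∀ v : EuclideanSpace ℝ (Fin n),
        ∫ x, u x * fderiv ℝ φ x v = - ∫ x, inner ℝ (G x) v * φ x

/-- Membership in the Sobolev space `W^{1,p}(ℝⁿ)`. -/
def MemW1p {n : ℕ} (u : EuclideanSpace ℝ (Fin n) → ℝ) (p : ℝ≥0∞) : Prop :=
  MemLp u p volume ∧
    ∃ G : EuclideanSpace ℝ (Fin n) → EuclideanSpace ℝ (Fin n),
      HasWeakGradient u G ∧ MemLp G p volume

/-- The Hopf-Lax formula (infimal convolution of `u` with respect to `L`):
`u_t(x) = inf_y (u(y) + t L((y - x)/t))`. -/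
noncomputable def hopfLax {n : ℕ} (L u : EuclideanSpace ℝ (Fin n) → ℝ) (t : ℝ)
    (x : EuclideanSpace ℝ (Fin n)) : ℝ :=
  ⨅ y : EuclideanSpace ℝ (Fin n), (u y + t * L (t⁻¹ • (y - x)))

/-! Where `L = exp ‖x‖`, the gradient of `L` is as large as `L` itself, so no bound by `C * L x /
‖x‖` can survive as `‖x‖ → ∞`.

For the blow-up, take a radial `u` with a sharp minimum at the origin, with profile `h r = r ^ γ *
|log r| ^ (-β)`, `γ = 1 - n/p`. The power alone just misses W^{1,p}: `r ^ (n-1) * |h'| ^ p` would be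
of order `1/r`. The logarithm supplies a factor `|log r| ^ (-β p)`, integrable against `1/r` once `β
p > 1`.

Fix small `t`, put `l = -log t` and define `q` by `h t = t * exp q`, so that `q = (1-γ) l - β log
l`. If `t(q-1) ≤ ‖x‖ < tq`, the competitor `y = 0` costs less than `u 0 + t * exp q`, whereas every
`y` with `‖y‖ > t` costs at least that much. The minimizer therefore lies within `t` of the origin,
the scaled displacement has norm at least `q - 2`, and `‖Du_t x‖ ≥ exp (q - 2)`
(`exp_le_norm_fderiv_hopfLax`). The annulus has volume at least a constant times `t ^ n * q ^ (n-1)`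
(`le_volume_annulus`). Since `exp (p q) * t ^ n = l ^ (-β p)`, the p-th power of the norm is at
least a constant times `l ^ (n - 1 - β p)`. A choice `1 < β p < n - 1` thus gives both membership in
W^{1,p} and blow-up, and it exists because `n ≥ 3`. -/

/-! ### The exponential Lagrangian and its gradient -/

/-- Differentiating in the radial direction gives `DL(x) x = exp ‖x‖ * ‖x‖`; divide by `‖x‖`. -/
theorem exp_norm_le_norm_fderiv {E : Type*} [NormedAddCommGroup E] [InnerProductSpace ℝ E]
    {r₀ : ℝ} (hr₀ : 0 < r₀) {L : E → ℝ} (hL : ∀ x, r₀ ≤ ‖x‖ → L x = Real.exp ‖x‖)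
    {x : E} (hx : r₀ < ‖x‖) : Real.exp ‖x‖ ≤ ‖fderiv ℝ L x‖ := by
  have hx0 : 0 < ‖x‖ := hr₀.trans hx
  have heq : L =ᶠ[𝓝 x] fun y => Real.exp ‖y‖ := by
    filter_upwards [continuous_norm.continuousAt.eventually (lt_mem_nhds hx)] with y hy
    exact hL y hy.le
  have hd : DifferentiableAt ℝ (fun y : E => ‖y‖) x :=
    differentiableAt_id.norm ℝ (norm_pos_iff.1 hx0)
  have h1 : fderiv ℝ L x x = Real.exp ‖x‖ * ‖x‖ := by
    rw [heq.fderiv_eq, (hd.hasFDerivAt.exp).fderiv]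
    simp [hd.fderiv_norm_self]
  have h2 := (fderiv ℝ L x).le_opNorm x
  rw [h1, Real.norm_of_nonneg (by positivity)] at h2
  exact le_of_mul_le_mul_right h2 hx0

theorem exists_lt_norm (E : Type*) [NormedAddCommGroup E] [NormedSpace ℝ E] [Nontrivial E]
    (r : ℝ) : ∃ x : E, r < ‖x‖ := by
  obtain ⟨x, hx⟩ := exists_norm_eq E (c := |r| + 1) (by positivity)
  exact ⟨x, by rw [hx]; linarith [le_abs_self r]⟩

theorem not_exists_norm_fderiv_le_of_eq_exp {E : Type*} [NormedAddCommGroup E]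
    [InnerProductSpace ℝ E] [Nontrivial E] {r₀ : ℝ} (hr₀ : 0 < r₀) {L : E → ℝ}
    (hL : ∀ x, r₀ ≤ ‖x‖ → L x = Real.exp ‖x‖) :
    ¬ ∃ C : ℝ, 0 < C ∧ ∀ x, x ≠ 0 → ‖fderiv ℝ L x‖ ≤ C * (L x / ‖x‖) := by
  rintro ⟨C, hC, h⟩
  obtain ⟨x, hx⟩ := exists_lt_norm E (max r₀ C)
  have hxr : r₀ < ‖x‖ := (le_max_left _ _).trans_lt hx
  have hxC : C < ‖x‖ := (le_max_right _ _).trans_lt hx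
  have hx0 : 0 < ‖x‖ := hr₀.trans hxr
  have h1 := (exp_norm_le_norm_fderiv hr₀ hL hxr).trans (h x (norm_pos_iff.1 hx0))
  rw [hL x hxr.le, ← mul_div_assoc, le_div_iff₀ hx0, mul_comm] at h1
  exact absurd (le_of_mul_le_mul_right h1 (Real.exp_pos _)) (not_le.2 hxC)

/-! ### Minimizers, gradient and Lipschitz bound for the Hopf-Lax formula -/

section HopfLax

variable {n : ℕ} {L u : EuclideanSpace ℝ (Fin n) → ℝ} {r₀ M t : ℝ}

theorem tendsto_cocompact_of_eq_exp {E : Type*} [NormedAddCommGroup E] [ProperSpace E]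
    {L : E → ℝ} (hL : ∀ x, r₀ ≤ ‖x‖ → L x = Real.exp ‖x‖) :
    Tendsto L (cocompact E) atTop := by
  have h := tendsto_norm_cocompact_atTop (E := E)
  refine (Real.tendsto_exp_atTop.comp h).congr' ?_
  filter_upwards [h.eventually_ge_atTop r₀] with x hx using (hL x hx).symm

theorem exists_hopfLax_minimizer (hLc : Continuous L) (hLt : Tendsto L (cocompact _) atTop)
    (huc : Continuous u) (hu : ∀ y, |u y| ≤ M) (ht : 0 < t) (x : EuclideanSpace ℝ (Fin n)) :
    ∃ y, hopfLax L u t x = u y + t * L (t⁻¹ • (y - x)) ∧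
      ∀ z, u y + t * L (t⁻¹ • (y - x)) ≤ u z + t * L (t⁻¹ • (z - x)) := by
  let e : EuclideanSpace ℝ (Fin n) ≃ₜ EuclideanSpace ℝ (Fin n) :=
    (Homeomorph.subRight x).trans (Homeomorph.smulOfNeZero t⁻¹ (inv_ne_zero ht.ne'))
  have hlim : Tendsto (fun z => u z + t * L (t⁻¹ • (z - x))) (cocompact _) atTop := by
    refine tendsto_atTop_add_left_of_le _ (-M) (fun z => (abs_le.1 (hu z)).1) ?_
    exact (hLt.comp e.isClosedEmbedding.tendsto_cocompact).const_mul_atTop ht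
  obtain ⟨y, hy⟩ := Continuous.exists_forall_le (by fun_prop) hlim
  refine ⟨y, le_antisymm (ciInf_le ⟨_, Set.forall_mem_range.2 hy⟩ y) (le_ciInf hy), hy⟩

theorem hopfLax_le (hL0 : ∀ x, 0 ≤ L x) (hu : ∀ y, |u y| ≤ M) (ht : 0 < t)
    (x y : EuclideanSpace ℝ (Fin n)) : hopfLax L u t x ≤ u y + t * L (t⁻¹ • (y - x)) := by
  refine ciInf_le ⟨-M, Set.forall_mem_range.2 fun z => ?_⟩ y
  have := mul_nonneg ht.le (hL0 (t⁻¹ • (z - x)))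
  linarith [(abs_le.1 (hu z)).1]

/-- With the minimizer `y` for `x` frozen, `z ↦ u y + t * L ((y - z)/t)` lies above `u_t` and
touches it at `x`, so the two derivatives agree there; the factors `t` and `t⁻¹` cancel. -/
theorem norm_fderiv_hopfLax (hL0 : ∀ x, 0 ≤ L x) (hLd : Differentiable ℝ L)
    (hu : ∀ y, |u y| ≤ M) (ht : 0 < t) {x y : EuclideanSpace ℝ (Fin n)}
    (hy : hopfLax L u t x = u y + t * L (t⁻¹ • (y - x)))
    (hx : DifferentiableAt ℝ (hopfLax L u t) x) :
    ‖fderiv ℝ (hopfLax L u t) x‖ = ‖fderiv ℝ L (t⁻¹ • (y - x))‖ := by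
  set g : EuclideanSpace ℝ (Fin n) → ℝ :=
    fun z => u y + t * L (t⁻¹ • (y - z)) - hopfLax L u t z with hg
  have hmin : IsLocalMin g x := Eventually.of_forall fun z => by
    have := hopfLax_le hL0 hu ht z y
    simp only [hg, hy]
    linarith
  have hin : HasFDerivAt (fun z : EuclideanSpace ℝ (Fin n) => t⁻¹ • (y - z))
      (t⁻¹ • (-(ContinuousLinearMap.id ℝ _))) x :=
    ((hasFDerivAt_id x).const_sub y).const_smul t⁻¹
  have hd : HasFDerivAt g (t • (fderiv ℝ L (t⁻¹ • (y - x))).comp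
      (t⁻¹ • (-(ContinuousLinearMap.id ℝ _))) - fderiv ℝ (hopfLax L u t) x) x :=
    ((((hLd _).hasFDerivAt.comp x hin).const_mul t).const_add (u y)).sub hx.hasFDerivAt
  have h0 := hmin.hasFDerivAt_eq_zero hd
  rw [sub_eq_zero] at h0
  rw [← h0, ContinuousLinearMap.comp_smul, smul_smul, mul_inv_cancel₀ ht.ne', one_smul,
    ContinuousLinearMap.comp_neg, ContinuousLinearMap.comp_id, norm_neg]

/-- For points at distance at most `t`, reuse the minimizer of one as competitor for the other: its
scaled displacement is bounded by `ρ`, since `t * exp s ≤ 2M` forces `s ≤ 2M/t`, and `L` is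
Lipschitz on the ball of radius `ρ + 1`. For points farther apart, `|u_t| ≤ M` suffices. -/
theorem exists_lipschitzWith_hopfLax (hL0 : ∀ x, 0 ≤ L x) (hL00 : L 0 = 0) (hLC : ContDiff ℝ 1 L)
    (hL : ∀ x, r₀ ≤ ‖x‖ → L x = Real.exp ‖x‖) (huc : Continuous u) (hu : ∀ y, |u y| ≤ M)
    (ht : 0 < t) : ∃ K : NNReal, LipschitzWith K (hopfLax L u t) := by
  set ρ : ℝ := max r₀ (2 * M / t)
  obtain ⟨K, hK⟩ := hLC.contDiffOn.exists_lipschitzOnWith (s := Metric.closedBall 0 (ρ + 1))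
    one_ne_zero (convex_closedBall _ _) (isCompact_closedBall _ _)
  have hM : 0 ≤ M := (abs_nonneg _).trans (hu 0)
  have hle : ∀ z, hopfLax L u t z ≤ M := fun z => by
    have := hopfLax_le hL0 hu ht z z
    simp only [sub_self, smul_zero, hL00, mul_zero, add_zero] at this
    exact this.trans (abs_le.1 (hu z)).2
  have hge : ∀ z, -M ≤ hopfLax L u t z := fun z => le_ciInf fun y => by
    have := mul_nonneg ht.le (hL0 (t⁻¹ • (y - z)))
    linarith [(abs_le.1 (hu y)).1]
  refine ⟨max K (2 * M / t).toNNReal, LipschitzWith.of_le_add_mul _ fun x x' => ?_⟩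
  rcases le_or_gt (dist x x') t with hxx | hxx
  · obtain ⟨y, hy, -⟩ := exists_hopfLax_minimizer hLC.continuous (tendsto_cocompact_of_eq_exp hL)
      huc hu ht x'
    have hρ : ‖t⁻¹ • (y - x')‖ ≤ ρ := by
      rcases le_or_gt r₀ ‖t⁻¹ • (y - x')‖ with h | h
      · refine le_max_of_le_right ?_
        have h1 := hle x'
        rw [hy, hL _ h] at h1
        rw [le_div_iff₀ ht, mul_comm]
        have h2 := Real.add_one_le_exp ‖t⁻¹ • (y - x')‖
        nlinarith [(abs_le.1 (hu y)).1]
      · exact le_max_of_le_left h.le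
    have hsub : t⁻¹ • (y - x) - t⁻¹ • (y - x') = t⁻¹ • (x' - x) := by
      rw [← smul_sub]; congr 1; abel
    have hnorm : ‖t⁻¹ • (x' - x)‖ = t⁻¹ * dist x x' := by
      rw [norm_smul, Real.norm_of_nonneg (inv_nonneg.2 ht.le), dist_comm, dist_eq_norm]
    have hρ' : ‖t⁻¹ • (y - x)‖ ≤ ρ + 1 := by
      have h1 : t⁻¹ • (y - x) = t⁻¹ • (y - x') + t⁻¹ • (x' - x) := by rw [← hsub]; abel
      rw [h1]
      refine (norm_add_le _ _).trans (add_le_add hρ ?_)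
      rw [hnorm, inv_mul_le_one₀ ht]
      exact hxx
    have h1 := hK.dist_le_mul _ (mem_closedBall_zero_iff.2 hρ') _
      (mem_closedBall_zero_iff.2 (hρ.trans (by linarith)))
    rw [Real.dist_eq, dist_eq_norm, hsub, hnorm] at h1
    have h2 := hopfLax_le hL0 hu ht x y
    have h3 : t * L (t⁻¹ • (y - x)) ≤ t * L (t⁻¹ • (y - x')) + K * dist x x' := by
      have h4 : t * (K * (t⁻¹ * dist x x')) = K * dist x x' := by field_simp
      nlinarith [(abs_le.1 h1).2]
    have h5 : (K : ℝ) * dist x x' ≤ (max K (2 * M / t).toNNReal : NNReal) * dist x x' := by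
      gcongr
      exact le_max_left _ _
    linarith
  · have h5 : 2 * M / t * dist x x' ≤ (max K (2 * M / t).toNNReal : NNReal) * dist x x' := by
      gcongr
      exact (Real.le_coe_toNNReal _).trans (NNReal.coe_le_coe.2 (le_max_right _ _))
    have h6 : 2 * M ≤ 2 * M / t * dist x x' := by
      rw [div_mul_eq_mul_div, le_div_iff₀ ht]
      gcongr
    linarith [hle x, hge x']

end HopfLax

/-! ### Radial functions in W^{1,p} -/

theorem hasFDerivAt_norm_of_ne_zero {E : Type*} [NormedAddCommGroup E] [InnerProductSpace ℝ E]
    {x : E} (hx : x ≠ 0) : HasFDerivAt (fun y : E => ‖y‖) (‖x‖⁻¹ • innerSL ℝ x) x := by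
  have h := (hasStrictFDerivAt_norm_sq x).hasFDerivAt.sqrt
    (pow_ne_zero 2 (norm_ne_zero_iff.2 hx))
  simp only [Real.sqrt_sq (norm_nonneg _)] at h
  convert! h using 1
  rw [two_smul, ← two_smul ℝ, smul_smul]
  congr 1
  have := norm_ne_zero_iff.2 hx
  field_simp

/-- The gradient of the radial function `x ↦ h (min ‖x‖ R)`, where `h'` is the derivative
of `h`. -/
noncomputable def radialGradient {n : ℕ} (h' : ℝ → ℝ) (R : ℝ) :
    EuclideanSpace ℝ (Fin n) → EuclideanSpace ℝ (Fin n) :=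
  Set.indicator {x | 0 < ‖x‖ ∧ ‖x‖ < R} fun x => (h' ‖x‖ / ‖x‖) • x

section Radial

variable {n : ℕ} {h h' : ℝ → ℝ} {R : ℝ}

theorem measurableSet_punctured_ball :
    MeasurableSet {x : EuclideanSpace ℝ (Fin n) | 0 < ‖x‖ ∧ ‖x‖ < R} :=
  ((isOpen_lt continuous_const continuous_norm).inter
    (isOpen_lt continuous_norm continuous_const)).measurableSet

theorem memLp_radialGradient (hn : 1 ≤ n) {p : ℝ} (hp : 0 < p)
    (hc : ContinuousOn h' (Set.Ioo 0 R))
    (hint : IntegrableOn (fun r => r ^ (n - 1) * |h' r| ^ p) (Set.Ioo 0 R)) :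
    MemLp (radialGradient (n := n) h' R) (ENNReal.ofReal p) volume := by
  have : Nonempty (Fin n) := ⟨⟨0, hn⟩⟩
  rw [radialGradient, memLp_indicator_iff_restrict measurableSet_punctured_ball]
  have hcont : ContinuousOn (fun x : EuclideanSpace ℝ (Fin n) => (h' ‖x‖ / ‖x‖) • x)
      {x | 0 < ‖x‖ ∧ ‖x‖ < R} := by
    refine ContinuousOn.smul (ContinuousOn.div ?_ continuous_norm.continuousOn
      fun x hx => hx.1.ne') continuousOn_id
    exact hc.comp continuous_norm.continuousOn fun x hx => hx
  rw [← integrable_norm_rpow_iff (hcont.aestronglyMeasurable measurableSet_punctured_ball)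
    (by simpa using hp) ENNReal.ofReal_ne_top, ENNReal.toReal_ofReal hp.le, ← IntegrableOn]
  have hball : IntegrableOn (fun x : EuclideanSpace ℝ (Fin n) => |h' ‖x‖| ^ p)
      (Metric.ball 0 R) := by
    rw [integrableOn_fun_norm_addHaar volume (f := fun r => |h' r| ^ p), finrank_euclideanSpace_fin]
    simpa only [smul_eq_mul] using hint
  refine (hball.mono_set fun x hx => mem_ball_zero_iff.2 hx.2).congr_fun (fun x hx => ?_)
    measurableSet_punctured_ball
  have hx0 := hx.1.ne'
  dsimp only
  rw [norm_smul, norm_div, norm_norm, div_mul_cancel₀ _ hx0, Real.norm_eq_abs]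

theorem lipschitzWith_radial_truncation (hd : ∀ r ∈ Set.Ioc 0 R, HasDerivAt h (h' r) r)
    (hc : ContinuousOn h' (Set.Ioc 0 R)) {ε : ℝ} (hε : 0 < ε) (hεR : ε ≤ R) :
    ∃ K : NNReal, LipschitzWith K
      fun x : EuclideanSpace ℝ (Fin n) => h (max ε (min ‖x‖ R)) - h R := by
  have hsub : Set.Icc ε R ⊆ Set.Ioc 0 R := fun r hr => ⟨hε.trans_le hr.1, hr.2⟩
  obtain ⟨C, hC⟩ := isCompact_Icc.exists_bound_of_continuousOn (hc.mono hsub)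
  have hlip : LipschitzOnWith C.toNNReal h (Set.Icc ε R) :=
    (convex_Icc ε R).lipschitzOnWith_of_nnnorm_hasDerivWithin_le
      (fun r hr => (hd r (hsub hr)).hasDerivWithinAt) fun r hr => by
        rw [← NNReal.coe_le_coe, coe_nnnorm]
        exact (hC r hr).trans (Real.le_coe_toNNReal C)
  have hclamp : LipschitzWith 1 fun x : EuclideanSpace ℝ (Fin n) => max ε (min ‖x‖ R) :=
    (lipschitzWith_one_norm.min_const R).const_max ε
  refine ⟨C.toNNReal, LipschitzWith.of_dist_le_mul fun x y => ?_⟩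
  rw [dist_sub_right]
  refine (hlip.dist_le_mul _ ⟨le_max_left _ _, max_le hεR (min_le_right _ _)⟩ _
    ⟨le_max_left _ _, max_le hεR (min_le_right _ _)⟩).trans ?_
  gcongr
  simpa using hclamp.dist_le_mul x y

theorem lineDeriv_radial_truncation (hd : ∀ r ∈ Set.Ioc 0 R, HasDerivAt h (h' r) r)
    {ε : ℝ} (hε : 0 < ε) (hεR : ε ≤ R) {x : EuclideanSpace ℝ (Fin n)}
    (hxε : ‖x‖ ≠ ε) (hxR : ‖x‖ ≠ R) (v : EuclideanSpace ℝ (Fin n)) :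
    lineDeriv ℝ (fun x : EuclideanSpace ℝ (Fin n) => h (max ε (min ‖x‖ R)) - h R) x v =
      Set.indicator {x : EuclideanSpace ℝ (Fin n) | ε < ‖x‖}
        (fun x => inner ℝ (radialGradient h' R x) v) x := by
  have hcn : ContinuousAt (fun y : EuclideanSpace ℝ (Fin n) => ‖y‖) x :=
    continuous_norm.continuousAt
  rcases lt_or_gt_of_ne hxε with hlt | hgt
  · have heq : (fun x : EuclideanSpace ℝ (Fin n) => h (max ε (min ‖x‖ R)) - h R) =ᶠ[𝓝 x]
        fun _ => h ε - h R := by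
      filter_upwards [hcn.eventually (gt_mem_nhds hlt)] with y hy
      rw [max_eq_left ((min_le_left _ _).trans hy.le)]
    rw [(((hasFDerivAt_const _ _).congr_of_eventuallyEq heq).hasLineDerivAt v).lineDeriv,
      Set.indicator_of_notMem (by simpa using hlt.le)]
    simp
  · rw [Set.indicator_of_mem (by simpa using hgt)]
    rcases lt_or_gt_of_ne hxR with hlt | hgt'
    · have hx0 : 0 < ‖x‖ := hε.trans hgt
      have heq : (fun x : EuclideanSpace ℝ (Fin n) => h (max ε (min ‖x‖ R)) - h R) =ᶠ[𝓝 x]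
          fun y => h ‖y‖ - h R := by
        filter_upwards [hcn.eventually (gt_mem_nhds hlt), hcn.eventually (lt_mem_nhds hgt)]
          with y hy hy'
        rw [min_eq_left hy.le, max_eq_right hy'.le]
      have hder := ((hd ‖x‖ ⟨hx0, hlt.le⟩).comp_hasFDerivAt x
        (hasFDerivAt_norm_of_ne_zero (norm_pos_iff.1 hx0))).sub_const (h R)
      rw [((hder.congr_of_eventuallyEq heq).hasLineDerivAt v).lineDeriv, radialGradient,
        Set.indicator_of_mem (show x ∈ {x : EuclideanSpace ℝ (Fin n) | 0 < ‖x‖ ∧ ‖x‖ < R}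
          from ⟨hx0, hlt⟩), real_inner_smul_left]
      simp [div_eq_mul_inv, mul_assoc]
    · have heq : (fun x : EuclideanSpace ℝ (Fin n) => h (max ε (min ‖x‖ R)) - h R) =ᶠ[𝓝 x]
          fun _ => 0 := by
        filter_upwards [hcn.eventually (lt_mem_nhds hgt')] with y hy
        rw [min_eq_right hy.le, max_eq_right hεR, sub_self]
      rw [(((hasFDerivAt_const _ _).congr_of_eventuallyEq heq).hasLineDerivAt v).lineDeriv,
        radialGradient, Set.indicator_of_notMem (fun h => by linarith [h.2])]
      simp

theorem continuous_radial (hR : 0 ≤ R) (hh : ContinuousOn h (Set.Icc 0 R)) :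
    Continuous fun x : EuclideanSpace ℝ (Fin n) => h (min ‖x‖ R) - h R := by
  refine Continuous.sub ?_ continuous_const
  exact hh.comp_continuous (by fun_prop) fun x => ⟨le_min (norm_nonneg _) hR, min_le_right _ _⟩

theorem hasCompactSupport_radial :
    HasCompactSupport fun x : EuclideanSpace ℝ (Fin n) => h (min ‖x‖ R) - h R := by
  refine HasCompactSupport.intro (isCompact_closedBall 0 R) fun x hx => ?_
  rw [mem_closedBall_zero_iff, not_le] at hx
  rw [min_eq_right hx.le, sub_self]

/-- Since `h'` may blow up at 0, the profile is frozen below radius `ε`. The truncation is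
Lipschitz, so integration by parts applies, and dominated convergence lets `ε → 0`. -/
theorem hasWeakGradient_radial (hn : 1 ≤ n) (hR : 0 < R) (hh : ContinuousOn h (Set.Icc 0 R))
    (hd : ∀ r ∈ Set.Ioc 0 R, HasDerivAt h (h' r) r) (hc : ContinuousOn h' (Set.Ioc 0 R))
    (hG : LocallyIntegrable (radialGradient (n := n) h' R) volume) :
    HasWeakGradient (fun x : EuclideanSpace ℝ (Fin n) => h (min ‖x‖ R) - h R)
      (radialGradient h' R) := by
  have : Nonempty (Fin n) := ⟨⟨0, hn⟩⟩
  refine ⟨(continuous_radial hR.le hh).locallyIntegrable, hG, fun φ hφ hφc v => ?_⟩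
  set ε : ℕ → ℝ := fun k => R / (k + 1)
  have hε : ∀ k, 0 < ε k := fun k => by positivity
  have hεR : ∀ k, ε k ≤ R := fun k => div_le_self hR.le (by linarith [k.cast_nonneg (α := ℝ)])
  have hεlim : ∀ r : ℝ, 0 < r → ∀ᶠ k in atTop, ε k < r := fun r hr =>
    (tendsto_const_nhds.div_atTop (tendsto_atTop_add_const_right _ 1
      tendsto_natCast_atTop_atTop)).eventually (gt_mem_nhds hr)
  obtain ⟨C, hC⟩ := isCompact_Icc.exists_bound_of_continuousOn hh
  obtain ⟨D, hD⟩ := hφ.lipschitzWith_of_hasCompactSupport hφc (by simp)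
  have hsphere : ∀ r : ℝ, 0 < r → ∀ᵐ x : EuclideanSpace ℝ (Fin n), ‖x‖ ≠ r := fun r hr => by
    have := Measure.addHaar_sphere_of_ne_zero (volume : Measure (EuclideanSpace ℝ (Fin n))) 0 hr.ne'
    rw [← compl_mem_ae_iff] at this
    filter_upwards [this] with x hx using by simpa using hx
  have hφ' : ∀ w, Continuous fun x => fderiv ℝ φ x w := fun w =>
    (hφ.continuous_fderiv (by simp)).clm_apply continuous_const
  have hφc' : ∀ w, HasCompactSupport fun x => fderiv ℝ φ x w := fun w =>
    hφc.fderiv_apply ℝ w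
  have hparts : ∀ k, ∫ x, Set.indicator {x : EuclideanSpace ℝ (Fin n) | ε k < ‖x‖}
        (fun x => inner ℝ (radialGradient h' R x) v) x * φ x =
      ∫ x, fderiv ℝ φ x (-v) * (h (max (ε k) (min ‖x‖ R)) - h R) := fun k => by
    obtain ⟨K, hK⟩ := lipschitzWith_radial_truncation (n := n) hd hc (hε k) (hεR k)
    have := hK.integral_lineDeriv_mul_eq (μ := volume) hD hφc v
    simp_rw [((hφ.differentiable (by simp)) _).lineDeriv_eq_fderiv] at this
    rw [← this]
    refine integral_congr_ae ?_
    filter_upwards [hsphere _ (hε k), hsphere R hR] with x h1 h2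
    rw [lineDeriv_radial_truncation hd (hε k) (hεR k) h1 h2]
  have hleft : Tendsto (fun k => ∫ x, Set.indicator {x : EuclideanSpace ℝ (Fin n) | ε k < ‖x‖}
        (fun x => inner ℝ (radialGradient h' R x) v) x * φ x) atTop
      (𝓝 (∫ x, inner ℝ (radialGradient h' R x) v * φ x)) := by
    have hGm : AEStronglyMeasurable (radialGradient (n := n) h' R) volume := hG.aestronglyMeasurable
    have hint : Integrable (fun x => ‖v‖ * ‖φ x • radialGradient (n := n) h' R x‖) :=
      (hG.integrable_smul_left_of_hasCompactSupport hφ.continuous hφc).norm.const_mul _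
    refine tendsto_integral_of_dominated_convergence _ (fun k => ?_) hint (fun k => ?_) ?_
    · refine AEStronglyMeasurable.mul ?_ hφ.continuous.aestronglyMeasurable
      exact (hGm.inner aestronglyMeasurable_const).indicator
        (isOpen_lt continuous_const continuous_norm).measurableSet
    · refine Eventually.of_forall fun x => ?_
      rw [norm_mul, norm_smul]
      calc _ ≤ ‖radialGradient h' R x‖ * ‖v‖ * ‖φ x‖ := by
            gcongr
            exact (norm_indicator_le_norm_self _ _).trans (norm_inner_le_norm _ _)
        _ = _ := by ring
    · have h0 : ∀ᵐ x : EuclideanSpace ℝ (Fin n), x ≠ 0 := by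
        simp [ae_iff]
      filter_upwards [h0] with x hx
      refine tendsto_const_nhds.congr' ?_
      filter_upwards [hεlim _ (norm_pos_iff.2 hx)] with k hk
      rw [Set.indicator_of_mem (by simpa using hk)]
  have hright : Tendsto (fun k => ∫ x, fderiv ℝ φ x (-v) * (h (max (ε k) (min ‖x‖ R)) - h R)) atTop
      (𝓝 (∫ x, fderiv ℝ φ x (-v) * (h (min ‖x‖ R) - h R))) := by
    have hint : Integrable (fun x => ‖fderiv ℝ φ x (-v)‖ * (C + C)) :=
      ((hφ' (-v)).integrable_of_hasCompactSupport (hφc' (-v))).norm.mul_const _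
    refine tendsto_integral_of_dominated_convergence _ (fun k => ?_) hint (fun k => ?_) ?_
    · obtain ⟨K, hK⟩ := lipschitzWith_radial_truncation (n := n) hd hc (hε k) (hεR k)
      exact ((hφ' (-v)).mul hK.continuous).aestronglyMeasurable
    · refine Eventually.of_forall fun x => ?_
      rw [norm_mul]
      gcongr
      refine (norm_sub_le _ _).trans (add_le_add (hC _ ?_) (hC _ ⟨hR.le, le_rfl⟩))
      exact ⟨(hε k).le.trans (le_max_left _ _), max_le (hεR k) (min_le_right _ _)⟩
    · have h0 : ∀ᵐ x : EuclideanSpace ℝ (Fin n), x ≠ 0 := by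
        simp [ae_iff]
      filter_upwards [h0] with x hx
      refine tendsto_const_nhds.congr' ?_
      filter_upwards [hεlim _ (norm_pos_iff.2 hx)] with k hk
      rw [max_eq_right (le_min hk.le (hεR k))]
  have hlim := tendsto_nhds_unique (hleft.congr hparts) hright
  rw [hlim, ← integral_neg]
  refine integral_congr_ae (Eventually.of_forall fun x => ?_)
  simp only [map_neg]
  ring

theorem memW1p_radial (hn : 1 ≤ n) {p : ℝ} (hp : 1 ≤ p) (hR : 0 < R)
    (hh : ContinuousOn h (Set.Icc 0 R)) (hd : ∀ r ∈ Set.Ioc 0 R, HasDerivAt h (h' r) r)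
    (hc : ContinuousOn h' (Set.Ioc 0 R))
    (hint : IntegrableOn (fun r => r ^ (n - 1) * |h' r| ^ p) (Set.Ioo 0 R)) :
    MemW1p (fun x : EuclideanSpace ℝ (Fin n) => h (min ‖x‖ R) - h R) (ENNReal.ofReal p) := by
  have hG := memLp_radialGradient hn (zero_lt_one.trans_le hp)
    (hc.mono Set.Ioo_subset_Ioc_self) hint
  exact ⟨(continuous_radial hR.le hh).memLp_of_hasCompactSupport hasCompactSupport_radial,
    radialGradient h' R, hasWeakGradient_radial hn hR hh hd hc
      (hG.locallyIntegrable (by simpa using hp)), hG⟩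

end Radial

/-! ### The power-logarithm profile -/

/-- The profile `r ^ γ * |log r| ^ (-β)` for `0 ≤ r < 1`. -/
noncomputable def logPower (γ β r : ℝ) : ℝ := r ^ γ * (-Real.log r) ^ (-β)

/-- The derivative of `logPower`. -/
noncomputable def logPowerDeriv (γ β r : ℝ) : ℝ :=
  r ^ (γ - 1) * (γ * (-Real.log r) ^ (-β) + β * (-Real.log r) ^ (-β - 1))

section LogPower

variable {γ β : ℝ}

theorem one_le_neg_log {r : ℝ} (hr0 : 0 < r) (hr : r ≤ Real.exp (-1)) : 1 ≤ -Real.log r := by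
  have := Real.log_le_log hr0 hr
  rw [Real.log_exp] at this
  linarith

theorem tendsto_neg_log_nhdsGT : Tendsto (fun r => -Real.log r) (𝓝[>] 0) atTop :=
  tendsto_neg_atBot_atTop.comp Real.tendsto_log_nhdsGT_zero

theorem hasDerivAt_logPower {r : ℝ} (hr0 : 0 < r) (hr : r ≤ Real.exp (-1)) :
    HasDerivAt (logPower γ β) (logPowerDeriv γ β r) r := by
  have hl := one_le_neg_log hr0 hr
  have h1 : HasDerivAt (fun r : ℝ => r ^ γ) (γ * r ^ (γ - 1)) r :=
    Real.hasDerivAt_rpow_const (Or.inl hr0.ne')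
  have h2 : HasDerivAt (fun r : ℝ => (-Real.log r) ^ (-β)) _ r :=
    ((Real.hasDerivAt_log hr0.ne').neg).rpow_const (p := -β)
      (Or.inl (by change -Real.log r ≠ 0; linarith))
  refine (h1.mul h2).congr_deriv ?_
  have h3 : r ^ γ = r ^ (γ - 1) * r := by
    rw [← Real.rpow_add_one hr0.ne']; ring_nf
  rw [logPowerDeriv, h3]
  field_simp
  simp only [Pi.neg_apply]

theorem continuousAt_neg_log {r : ℝ} (hr0 : 0 < r) : ContinuousAt (fun r => -Real.log r) r :=
  (Real.continuousAt_log hr0.ne').neg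

theorem continuousOn_neg_log_rpow {b : ℝ} (hb : 0 < b) :
    ContinuousOn (fun r => (-Real.log r) ^ (-b)) (Set.Icc 0 (Real.exp (-1))) := by
  intro r hr
  rcases hr.1.eq_or_lt with rfl | hr0
  · rw [← Set.Ioc_insert_left (Real.exp_pos _).le, continuousWithinAt_insert_self]
    have h : Tendsto (fun r => (-Real.log r) ^ (-b)) (𝓝[>] 0) (𝓝 0) :=
      (tendsto_rpow_neg_atTop hb).comp tendsto_neg_log_nhdsGT
    -- The conventions `log 0 = 0` and `0 ^ (-b) = 0` happen to give the true limit at 0.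
    have h0 : (-Real.log 0) ^ (-b) = 0 := by
      rw [Real.log_zero, neg_zero, Real.zero_rpow (by linarith)]
    rw [ContinuousWithinAt, h0]
    exact h.mono_left (nhdsWithin_mono _ fun x hx => hx.1)
  · refine ((continuousAt_neg_log hr0).rpow_const (Or.inl ?_)).continuousWithinAt
    linarith [one_le_neg_log hr0 hr.2]

theorem continuousOn_logPower (hγ : 0 < γ) (hβ : 0 < β) :
    ContinuousOn (logPower γ β) (Set.Icc 0 (Real.exp (-1))) :=
  (Real.continuous_rpow_const hγ.le).continuousOn.mul (continuousOn_neg_log_rpow hβ)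

theorem continuousOn_logPowerDeriv :
    ContinuousOn (logPowerDeriv γ β) (Set.Ioc 0 (Real.exp (-1))) := by
  intro r hr
  have hl : -Real.log r ≠ 0 := by linarith [one_le_neg_log hr.1 hr.2]
  have h := continuousAt_neg_log hr.1
  exact ((continuousAt_id.rpow_const (Or.inl hr.1.ne')).mul
    (((h.rpow_const (Or.inl hl)).const_mul γ).add
      ((h.rpow_const (Or.inl hl)).const_mul β))).continuousWithinAt

theorem logPower_zero (hγ : 0 < γ) : logPower γ β 0 = 0 := by
  rw [logPower, Real.zero_rpow hγ.ne', zero_mul]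

theorem monotoneOn_logPower (hγ : 0 < γ) (hβ : 0 < β) :
    MonotoneOn (logPower γ β) (Set.Icc 0 (Real.exp (-1))) := by
  intro r hr s hs hrs
  rcases hr.1.eq_or_lt with rfl | hr0
  · rw [logPower_zero hγ]
    rcases hs.1.eq_or_lt with rfl | hs0
    · rw [logPower_zero hγ]
    · have := one_le_neg_log hs0 hs.2
      unfold logPower
      positivity
  · have hs0 := hr0.trans_le hrs
    have hl := one_le_neg_log hs0 hs.2
    unfold logPower
    have hlog := neg_le_neg (Real.log_le_log hr0 hrs)
    exact mul_le_mul (Real.rpow_le_rpow hr0.le hrs hγ.le)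
      (Real.rpow_le_rpow_of_nonpos (by linarith) hlog (by linarith))
      (Real.rpow_nonneg (by linarith) _) (Real.rpow_nonneg hs0.le _)

/-- Up to the factor `b`, the integrand is the nonnegative derivative of `(-log r) ^ (-b)`, which is
continuous up to 0. -/
theorem integrableOn_inv_mul_neg_log_rpow {b : ℝ} (hb : 0 < b) :
    IntegrableOn (fun r => r⁻¹ * (-Real.log r) ^ (-b - 1)) (Set.Ioc 0 (Real.exp (-1))) := by
  have key : IntegrableOn (fun r => b * (r⁻¹ * (-Real.log r) ^ (-b - 1)))
      (Set.Ioc 0 (Real.exp (-1))) := by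
    refine intervalIntegral.integrableOn_deriv_of_nonneg (continuousOn_neg_log_rpow hb)
      (fun r hr => ?_) (fun r hr => ?_)
    · have hl := one_le_neg_log hr.1 hr.2.le
      have h2 : HasDerivAt (fun r : ℝ => (-Real.log r) ^ (-b)) _ r :=
        ((Real.hasDerivAt_log hr.1.ne').neg).rpow_const (p := -b)
          (Or.inl (by change -Real.log r ≠ 0; linarith))
      refine h2.congr_deriv ?_
      simp only [Pi.neg_apply]
      ring
    · have hl := one_le_neg_log hr.1 hr.2.le
      have := hr.1
      positivity
  refine (key.const_mul b⁻¹).congr (Eventually.of_forall fun r => ?_)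
  change b⁻¹ * (b * _) = _
  rw [inv_mul_cancel_left₀ hb.ne']

theorem integrableOn_logPowerDeriv {n : ℕ} (hn : 1 ≤ n) {p : ℝ} (hp : 0 < p) (hγ : 0 ≤ γ)
    (hβ : 0 < β) (hγp : (1 - γ) * p = n) (hβp : 1 < β * p) :
    IntegrableOn (fun r => r ^ (n - 1) * |logPowerDeriv γ β r| ^ p)
      (Set.Ioo 0 (Real.exp (-1))) := by
  have hdom := ((integrableOn_inv_mul_neg_log_rpow (b := β * p - 1) (by linarith)).mono_set
    Set.Ioo_subset_Ioc_self).const_mul ((γ + β) ^ p)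
  refine Integrable.mono' hdom ?_ ?_
  · refine ContinuousOn.aestronglyMeasurable ?_ measurableSet_Ioo
    refine (continuous_pow _).continuousOn.mul (ContinuousOn.rpow_const ?_ fun _ _ => Or.inr hp.le)
    exact (continuousOn_logPowerDeriv.mono Set.Ioo_subset_Ioc_self).abs
  · refine (ae_restrict_iff' measurableSet_Ioo).2 (Eventually.of_forall fun r hr => ?_)
    have hr0 := hr.1
    have hl := one_le_neg_log hr0 hr.2.le
    set l := -Real.log r
    have hl0 : 0 < l := by linarith
    have hnn : 0 ≤ logPowerDeriv γ β r := by unfold logPowerDeriv; positivity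
    have hle : logPowerDeriv γ β r ≤ (γ + β) * (r ^ (γ - 1) * l ^ (-β)) := by
      have : l ^ (-β - 1) ≤ l ^ (-β) := Real.rpow_le_rpow_of_exponent_le hl (by linarith)
      calc logPowerDeriv γ β r ≤ r ^ (γ - 1) * (γ * l ^ (-β) + β * l ^ (-β)) := by
            unfold logPowerDeriv; gcongr
        _ = _ := by ring
    rw [Real.norm_of_nonneg (by positivity), abs_of_nonneg hnn]
    calc r ^ (n - 1) * logPowerDeriv γ β r ^ p
        ≤ r ^ (n - 1) * ((γ + β) * (r ^ (γ - 1) * l ^ (-β))) ^ p := by gcongr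
      _ = (γ + β) ^ p * (r ^ (n - 1) * (r ^ (γ - 1)) ^ p * (l ^ (-β)) ^ p) := by
          rw [Real.mul_rpow (by positivity) (by positivity),
            Real.mul_rpow (by positivity) (by positivity)]
          ring
      _ = _ := by
          rw [← Real.rpow_mul hr0.le, ← Real.rpow_mul hl0.le, ← Real.rpow_natCast r,
            ← Real.rpow_add hr0, ← Real.rpow_neg_one r]
          have e1 : ((n - 1 : ℕ) : ℝ) + (γ - 1) * p = -1 := by
            rw [Nat.cast_sub hn]; push_cast; linarith
          have e2 : -β * p = -(β * p - 1) - 1 := by ring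
          rw [e1, e2]

/-- The exponent found here is the scale `q` at which the cost `t * exp q` of travelling `t * q`
equals the height of the profile at radius `t`. -/
theorem logPower_eq_mul_exp {t : ℝ} (ht : 0 < t) (hl : 0 < -Real.log t) :
    logPower γ β t =
      t * Real.exp ((1 - γ) * (-Real.log t) - β * Real.log (-Real.log t)) := by
  conv_rhs => rw [← Real.exp_log ht]
  rw [logPower, Real.rpow_def_of_pos ht, Real.rpow_def_of_pos hl, ← Real.exp_add, ← Real.exp_add,
    Real.log_exp]
  congr 1
  ring

theorem eventually_half_mul_le_sub_log {a : ℝ} (ha : 0 < a) (b : ℝ) :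
    ∀ᶠ l in atTop, a / 2 * l ≤ a * l - b * Real.log l := by
  have h := (Real.isLittleO_log_id_atTop.const_mul_left b).bound (half_pos ha)
  filter_upwards [h, eventually_ge_atTop 0] with l hl h0
  rw [Real.norm_eq_abs, id, Real.norm_of_nonneg h0] at hl
  linarith [(abs_le.1 hl).2]

end LogPower

/-! ### Lower bound for the gradient on an annulus, and blow-up -/

theorem exp_le_norm_fderiv_hopfLax {n : ℕ} {L : EuclideanSpace ℝ (Fin n) → ℝ} {r₀ : ℝ}
    (hr₀ : 0 < r₀) (hL0 : ∀ x, 0 ≤ L x) (hLC : ContDiff ℝ 1 L)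
    (hL : ∀ x, r₀ ≤ ‖x‖ → L x = Real.exp ‖x‖) {u : EuclideanSpace ℝ (Fin n) → ℝ} {M : ℝ}
    (huc : Continuous u) (hu : ∀ y, |u y| ≤ M) {t q : ℝ} (ht : 0 < t) (hq : r₀ < q - 2)
    (hspike : ∀ y, t < ‖y‖ → u 0 + t * Real.exp q ≤ u y) {x : EuclideanSpace ℝ (Fin n)}
    (hx1 : t * (q - 1) ≤ ‖x‖) (hx2 : ‖x‖ < t * q)
    (hx : DifferentiableAt ℝ (hopfLax L u t) x) :
    Real.exp (q - 2) ≤ ‖fderiv ℝ (hopfLax L u t) x‖ := by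
  obtain ⟨y, hy, hmin⟩ := exists_hopfLax_minimizer hLC.continuous
    (tendsto_cocompact_of_eq_exp hL) huc hu ht x
  rw [norm_fderiv_hopfLax hL0 (hLC.differentiable one_ne_zero) hu ht hy hx]
  have hscale : ∀ z : EuclideanSpace ℝ (Fin n), ‖t⁻¹ • z‖ = ‖z‖ / t := fun z => by
    rw [norm_smul, Real.norm_of_nonneg (inv_nonneg.2 ht.le), inv_mul_eq_div]
  have hyt : ‖y‖ ≤ t := by
    by_contra! hlt
    have h0 := hmin 0
    have hx0 : ‖t⁻¹ • (0 - x)‖ = ‖x‖ / t := by rw [hscale, zero_sub, norm_neg]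
    have hge : q - 1 ≤ ‖x‖ / t := by rwa [le_div_iff₀ ht, mul_comm]
    have hlt' : ‖x‖ / t < q := by rwa [div_lt_iff₀ ht, mul_comm]
    rw [hL (t⁻¹ • (0 - x)) (by rw [hx0]; linarith), hx0] at h0
    have h1 := mul_lt_mul_of_pos_left (Real.exp_lt_exp.2 hlt') ht
    have h2 := mul_nonneg ht.le (hL0 (t⁻¹ • (y - x)))
    linarith [hspike y hlt]
  have hz : q - 2 ≤ ‖t⁻¹ • (y - x)‖ := by
    rw [hscale, le_div_iff₀ ht]
    have := norm_sub_norm_le x y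
    rw [norm_sub_rev] at this
    linarith
  exact (Real.exp_le_exp.2 hz).trans (exp_norm_le_norm_fderiv hr₀ hL (hq.trans_le hz))

/-- This is `q ^ n - (q-1) ^ n ≥ q ^ (n-1)`, a consequence of `(q-1) ^ (n-1) ≤ q ^ (n-1)`. -/
theorem le_volume_annulus {n : ℕ} (hn : 1 ≤ n) {t q : ℝ} (ht : 0 < t) (hq : 1 ≤ q) :
    ENNReal.ofReal (t ^ n * q ^ (n - 1)) *
        volume (Metric.ball (0 : EuclideanSpace ℝ (Fin n)) 1) ≤
      volume {x : EuclideanSpace ℝ (Fin n) | t * (q - 1) ≤ ‖x‖ ∧ ‖x‖ < t * q} := by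
  have : Nonempty (Fin n) := ⟨⟨0, hn⟩⟩
  have hset : {x : EuclideanSpace ℝ (Fin n) | t * (q - 1) ≤ ‖x‖ ∧ ‖x‖ < t * q} =
      Metric.ball 0 (t * q) \ Metric.ball 0 (t * (q - 1)) := by
    ext x
    simp [and_comm]
  rw [hset]
  refine le_trans ?_ le_measure_sdiff
  have hq1 : 0 ≤ q - 1 := by linarith
  rw [Measure.addHaar_ball _ _ (show 0 ≤ t * q by positivity),
    Measure.addHaar_ball _ _ (show 0 ≤ t * (q - 1) by positivity),
    finrank_euclideanSpace_fin, ← ENNReal.sub_mul (fun _ _ => measure_ball_lt_top.ne),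
    ← ENNReal.ofReal_sub _ (by positivity)]
  gcongr
  obtain ⟨m, rfl⟩ : ∃ m, n = m + 1 := ⟨n - 1, by omega⟩
  rw [Nat.add_sub_cancel, mul_pow, mul_pow, ← mul_sub]
  gcongr
  have h1 : (q - 1) ^ m ≤ q ^ m := by gcongr; linarith
  rw [pow_succ, pow_succ]
  nlinarith

/-- Chebyshev's inequality. -/
theorem ofReal_mul_le_eLpNorm_rpow {α F : Type*} [MeasurableSpace α] [NormedAddCommGroup F]
    {μ : Measure α} {f : α → F} (hf : AEStronglyMeasurable f μ) {p : ℝ} (hp : 0 < p) {c : ℝ}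
    (hc : 0 ≤ c) {s : Set α} (h : ∀ᵐ x ∂μ, x ∈ s → c ≤ ‖f x‖) :
    ENNReal.ofReal (c ^ p) * μ s ≤ eLpNorm f (ENNReal.ofReal p) μ ^ p := by
  have key := mul_meas_ge_le_pow_eLpNorm' μ (p := ENNReal.ofReal p) (by simpa using hp)
    ENNReal.ofReal_ne_top hf (ENNReal.ofReal c)
  rw [ENNReal.toReal_ofReal hp.le, ENNReal.ofReal_rpow_of_nonneg hc hp.le] at key
  refine le_trans ?_ key
  gcongr 1
  refine measure_mono_ae ?_
  filter_upwards [h] with x hx hxs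
  have : ENNReal.ofReal c ≤ ‖f x‖ₑ := by
    rw [← ofReal_norm]
    exact ENNReal.ofReal_le_ofReal (hx hxs)
  exact this

theorem theorem3p1 (n : ℕ) (hn : 3 ≤ n) (p : ℝ) (hp : (n : ℝ) < p)
    (r₀ : ℝ) (hr₀ : 0 < r₀)
    (L : EuclideanSpace ℝ (Fin n) → ℝ)
    (hL_nonneg : ∀ x, 0 ≤ L x)
    (hL_C1 : ContDiff ℝ 1 L)
    (hL_exp : ∀ x, r₀ ≤ ‖x‖ → L x = Real.exp ‖x‖)
    (hL_convex : StrictConvexOn ℝ (Metric.ball 0 r₀) L)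
    (hL_zero : L 0 = 0) (hDL_zero : fderiv ℝ L 0 = 0) :
    (¬ ∃ C : ℝ, 0 < C ∧ ∀ x, x ≠ 0 → ‖fderiv ℝ L x‖ ≤ C * (L x / ‖x‖)) ∧
    ∃ u : EuclideanSpace ℝ (Fin n) → ℝ,
      Continuous u ∧ HasCompactSupport u ∧ MemW1p u (ENNReal.ofReal p) ∧
      (∀ t : ℝ, 0 < t → ∃ K : NNReal, LipschitzWith K (hopfLax L u t)) ∧
      Tendsto (fun t : ℝ => eLpNorm (fderiv ℝ (hopfLax L u t)) (ENNReal.ofReal p) volume)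
        (𝓝[>] (0 : ℝ)) (𝓝 (⊤ : ℝ≥0∞)) := by
  have hn1 : 1 ≤ n := by omega
  have : Nonempty (Fin n) := ⟨⟨0, hn1⟩⟩
  have hn0 : (0 : ℝ) < n := by exact_mod_cast hn1
  have hp0 : 0 < p := hn0.trans hp
  have hp1 : 1 ≤ p := le_trans (by exact_mod_cast hn1) hp.le
  set γ : ℝ := 1 - n / p with hγdef
  -- The value `β p = 3/2` lies strictly between 1 and 2, hence below `n - 1` for every `n ≥ 3`.
  set β : ℝ := 3 / 2 / p with hβdef
  set R : ℝ := Real.exp (-1)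
  have hγ : 0 < γ := sub_pos.2 ((div_lt_one hp0).2 hp)
  have hβ : 0 < β := by positivity
  have hγp : (1 - γ) * p = n := by rw [hγdef]; field_simp; ring
  have hβp : β * p = 3 / 2 := by rw [hβdef]; field_simp
  have hR : 0 < R := Real.exp_pos _
  set h := logPower γ β
  have hcont : ContinuousOn h (Set.Icc 0 R) := continuousOn_logPower hγ hβ
  set u : EuclideanSpace ℝ (Fin n) → ℝ := fun x => h (min ‖x‖ R) - h R with hu_def
  have huc : Continuous u := continuous_radial hR.le hcont
  have hus : HasCompactSupport u := hasCompactSupport_radial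
  obtain ⟨M, hM⟩ := huc.bounded_above_of_compact_support hus
  have hlip : ∀ t : ℝ, 0 < t → ∃ K : NNReal, LipschitzWith K (hopfLax L u t) := fun t ht =>
    exists_lipschitzWith_hopfLax hL_nonneg hL_zero hL_C1 hL_exp huc hM ht
  refine ⟨not_exists_norm_fderiv_le_of_eq_exp hr₀ hL_exp, u, huc, hus, ?_, hlip, ?_⟩
  · exact memW1p_radial hn1 hp1 hR hcont (fun r hr => hasDerivAt_logPower hr.1 hr.2)
      continuousOn_logPowerDeriv
      (integrableOn_logPowerDeriv hn1 hp0 hγ.le hβ hγp (by rw [hβp]; norm_num))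
  set w := volume (Metric.ball (0 : EuclideanSpace ℝ (Fin n)) 1)
  have hw : w ≠ 0 := (Metric.measure_ball_pos _ _ one_pos).ne'
  set a : ℝ := (1 - γ) / 2
  have hγ1 : 0 < 1 - γ := by rw [hγdef, sub_sub_cancel]; positivity
  have ha : 0 < a := half_pos hγ1
  set c : ℝ := Real.exp (-2 * p) * a ^ 2
  have hc : 0 < c := by positivity
  have hbound : ∀ᶠ t : ℝ in 𝓝[>] 0,
      ENNReal.ofReal (c * (-Real.log t) ^ (1 / 2 : ℝ)) * w ≤
        eLpNorm (fderiv ℝ (hopfLax L u t)) (ENNReal.ofReal p) volume ^ p := by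
    have hl := tendsto_neg_log_nhdsGT
    filter_upwards [self_mem_nhdsWithin, hl.eventually_ge_atTop 1,
      hl.eventually (eventually_half_mul_le_sub_log hγ1 β),
      hl.eventually_gt_atTop ((r₀ + 2) / a)] with t ht hl1 hq hl2
    rw [Set.mem_Ioi] at ht
    set l := -Real.log t with hldef
    set q := (1 - γ) * l - β * Real.log l with hqdef
    have hl0 : 0 < l := by linarith
    have haq : a * l ≤ q := hq
    have hq2 : r₀ < q - 2 := by
      rw [div_lt_iff₀ ha] at hl2
      linarith
    have hht : h t = t * Real.exp q := logPower_eq_mul_exp ht hl0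
    have htR : t ≤ R := by
      rw [← Real.exp_log ht]
      exact Real.exp_le_exp.2 (by linarith)
    have hspike : ∀ y, t < ‖y‖ → u 0 + t * Real.exp q ≤ u y := fun y hy => by
      have h1 : h t ≤ h (min ‖y‖ R) := monotoneOn_logPower hγ hβ ⟨ht.le, htR⟩
        ⟨le_min (norm_nonneg _) hR.le, min_le_right _ _⟩ (le_min hy.le htR)
      have h0 : h 0 = 0 := logPower_zero hγ
      simp only [hu_def, norm_zero, min_eq_left hR.le, h0, ← hht]
      linarith
    obtain ⟨K, hK⟩ := hlip t ht
    have hae : ∀ᵐ x, x ∈ {x : EuclideanSpace ℝ (Fin n) | t * (q - 1) ≤ ‖x‖ ∧ ‖x‖ < t * q} →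
        Real.exp (q - 2) ≤ ‖fderiv ℝ (hopfLax L u t) x‖ := by
      filter_upwards [hK.ae_differentiableAt (μ := volume)] with x hx hxs
      exact exp_le_norm_fderiv_hopfLax hr₀ hL_nonneg hL_C1 hL_exp huc hM ht hq2 hspike hxs.1
        hxs.2 hx
    refine le_trans ?_ (ofReal_mul_le_eLpNorm_rpow
      (measurable_fderiv ℝ _).aestronglyMeasurable hp0 (Real.exp_pos _).le hae)
    refine le_trans ?_ (mul_le_mul_right (le_volume_annulus hn1 ht (by linarith)) _)
    rw [← mul_assoc, ← ENNReal.ofReal_mul (by positivity)]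
    refine mul_le_mul_left (ENNReal.ofReal_le_ofReal ?_) _
    -- Here `n ≥ 3` enters: the annulus contributes at least `l ^ 2`, which beats the loss `l ^
    -- (-3/2)`.
    have hq3 : (a * l) ^ 2 ≤ q ^ (n - 1) := calc
      (a * l) ^ 2 ≤ q ^ 2 := by gcongr
      _ ≤ q ^ (n - 1) := pow_le_pow_right₀ (by linarith) (by omega)
    -- The choice of `γ` makes `exp (n l)` cancel `t ^ n` exactly, leaving only powers of `l`.
    have hlow : Real.exp (q - 2) ^ p * t ^ n = Real.exp (-2 * p) * l ^ (-(3 / 2) : ℝ) := by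
      have htn : t ^ n = Real.exp (-(n * l)) := by
        rw [hldef, mul_neg, neg_neg, Real.exp_nat_mul, Real.exp_log ht]
      rw [htn, ← Real.exp_mul, Real.rpow_def_of_pos hl0, ← Real.exp_add, ← Real.exp_add]
      congr 1
      rw [hqdef, ← hβp, ← hγp]
      ring
    calc c * l ^ (1 / 2 : ℝ) = Real.exp (-2 * p) * l ^ (-(3 / 2) : ℝ) * (a * l) ^ 2 := by
          have : l ^ (1 / 2 : ℝ) = l ^ (-(3 / 2) : ℝ) * l ^ 2 := by
            rw [← Real.rpow_natCast l 2, ← Real.rpow_add hl0]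
            norm_num
          rw [this]
          ring
      _ ≤ Real.exp (-2 * p) * l ^ (-(3 / 2) : ℝ) * q ^ (n - 1) := by gcongr
      _ = _ := by rw [← hlow]; ring
  have htop : Tendsto (fun t : ℝ => ENNReal.ofReal (c * (-Real.log t) ^ (1 / 2 : ℝ)) * w)
      (𝓝[>] 0) (𝓝 ⊤) := by
    have h1 : Tendsto (fun t : ℝ => c * (-Real.log t) ^ (1 / 2 : ℝ)) (𝓝[>] 0) atTop :=
      ((tendsto_rpow_atTop (by norm_num)).comp tendsto_neg_log_nhdsGT).const_mul_atTop hc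
    have h2 := ENNReal.Tendsto.mul_const (ENNReal.tendsto_ofReal_nhds_top.2 h1) (b := w)
      (Or.inl ENNReal.top_ne_zero)
    rwa [ENNReal.top_mul hw] at h2
  have hpow := ((ENNReal.continuous_rpow_const (y := p⁻¹)).tendsto ⊤).comp
    (tendsto_nhds_top_mono htop hbound)
  rw [ENNReal.top_rpow_of_pos (inv_pos.2 hp0)] at hpow
  refine hpow.congr fun t => ?_
  simp only [Function.comp_apply]
  rw [← ENNReal.rpow_mul, mul_inv_cancel₀ hp0.ne', ENNReal.rpow_one]
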